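/- Let $k,\ell,n\ge 0$ be integers. For a finite-dimensional real vector space $W$ let $\mathrm{Alt}^{k,\ell}(W)=\mathrm{Alt}^k(W)\otimes\mathrm{Alt}^\ell(W)$, viewed as the space of alternating $k$-forms on $W$ with values in the alternating $\ell$-forms on $W$. For a simplex $\sigma$ in a Euclidean space $\mathbb R^d$ with tangent space $T_\sigma$, let $$\mathcal P^-\mathrm{Alt}^{k,\ell}(\sigma)=\mathrm{Alt}^{k,\ell}(T_\sigma)+\kappa\,\mathrm{Alt}^{k+1,\ell}(T_\sigma)=\mathcal P^-\mathrm{Alt}^{k}(\sigma)\otimes\mathrm{Alt}^\ell(T_\sigma)$$ be the space of fields on $\sigma$ of the form $x\mapsto a+(\kappa b)_x$ with constant $a\in \mathrm{Alt}^{k,\ell}(T_\sigma)$, $b\in\mathrm{Alt}^{k+1,\ell}(T_\sigma)$, where $(\kappa b)_x(v_1,\dots,v_k)=b(x-x_0,v_1,\dots,v_k)$ and $x_0\in\sigma$ is fixed (the space does not depend on $x_0$). For a subsimplex $F$ of $\sigma$ let $\iota_F^*\iota_F^*\omega$ be the double trace: the field on $F$ obtained by restricting the points to $F$ and all $k+\ell$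 arguments of $\omega$ to $T_F$. Let $$\mathcal B^-\mathrm{Alt}^{k,\ell}(\sigma)=\{\omega\in\mathcal P^-\mathrm{Alt}^{k,\ell}(\sigma):\ \iota_F^*\iota_F^*\omega=0\ \text{ for every proper subsimplex } F \text{ of }\sigma\},$$ and let $\langle\cdot,\cdot\rangle_\sigma$ be the $L^2$ inner product of fields on $\sigma$ (point evaluation if $\sigma$ is a vertex). (1) (Unisolvence.) Let $K$ be an $n$-simplex. The degrees of freedom $$\omega\mapsto\langle\iota_\sigma^*\iota_\sigma^*\omega,b\rangle_\sigma,\qquad b\in\mathcal B^-\mathrm{Alt}^{k,\ell}(\sigma),\quad \sigma\text{ a subsimplex of }K\ (\text{of any dimension }0,\dots,n),$$ are unisolvent for the shape space $\mathcal P^-\mathrm{Alt}^{k,\ell}(K)$: for every choice of linear functionals $g_\sigma$ on $\mathcal B^-\mathrm{Alt}^{k,\ell}(\sigma)$, one for each subsimplex $\sigma$ of $K$, there is exactly one $\omega\in\mathcal P^-\mathrm{Alt}^{k,\ell}(K)$ such that $\langle\iota_\sigma^*\iota_\sigma^*\omega,b\rangle_\sigma=g_\sigma(b)$ for all $\sigma$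 and all $b\in\mathcal B^-\mathrm{Alt}^{k,\ell}(\sigma)$. (2) (Conformity.) Let $\mathcal T$ be a simplicial complex in $\mathbb R^d$, and let $(\omega_K)_K$ be a family indexed by the $n$-simplices of $\mathcal T$ with $\omega_K\in\mathcal P^-\mathrm{Alt}^{k,\ell}(K)$ whose degrees of freedom are single-valued, that is, $\langle\iota_\sigma^*\iota_\sigma^*\omega_K,b\rangle_\sigma=\langle\iota_\sigma^*\iota_\sigma^*\omega_{K'},b\rangle_\sigma$ for all $\sigma\in\mathcal T$, all $n$-simplices $K,K'\in\mathcal T$ containing $\sigma$ and all $b\in\mathcal B^-\mathrm{Alt}^{k,\ell}(\sigma)$. (These families form the global finite element space $C_{\iota^*\iota^*}\mathcal P^-\mathrm{Alt}^{k,\ell}$.) Then $(\omega_K)_K$ is $\iota^*\iota^*$-conforming: $\iota_\sigma^*\iota_\sigma^*\omega_K=\iota_\sigma^*\iota_\sigma^*\omega_{K'}$ for all $\sigma\in\mathcal T$, of every dimension, and all $n$-simplices $K,K'\in\mathcal T$ containing $\sigma$. -/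

import Mathlib

open scoped MeasureTheory

noncomputable section

namespace FormValued

/-- Algebraic `(k,ℓ)`-forms on `W`: alternating `k`-forms on `W` with values in the alternating
`ℓ`-forms on `W`, i.e. `Alt^k(W) ⊗ Alt^ℓ(W)` for finite-dimensional `W`. -/
abbrev Alt (k ℓ : ℕ) (W : Type*) [AddCommGroup W] [Module ℝ W] : Type _ :=
  W [⋀^Fin k]→ₗ[ℝ] (W [⋀^Fin ℓ]→ₗ[ℝ] ℝ)

/-- Pullback of alternating `ℓ`-forms along a linear map, as a linear map. -/
def pullbackₗ (ℓ : ℕ) {U W : Type*} [AddCommGroup U] [Module ℝ U] [AddCommGroup W] [Module ℝ W]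
    (f : U →ₗ[ℝ] W) : (W [⋀^Fin ℓ]→ₗ[ℝ] ℝ) →ₗ[ℝ] (U [⋀^Fin ℓ]→ₗ[ℝ] ℝ) where
  toFun α := α.compLinearMap f
  map_add' _ _ := rfl
  map_smul' _ _ := rfl

/-- Pullback of a `(k,ℓ)`-form in both indices:
`(pullback f α)(v₁,…,v_k)(u₁,…,u_ℓ) = α(f v₁,…,f v_k)(f u₁,…,f u_ℓ)`. -/
def pullback {k ℓ : ℕ} {U W : Type*} [AddCommGroup U] [Module ℝ U] [AddCommGroup W] [Module ℝ W]
    (f : U →ₗ[ℝ] W) (α : Alt k ℓ W) : Alt k ℓ U :=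
  (pullbackₗ ℓ f).compAlternatingMap (α.compLinearMap f)

/-- The Euclidean inner product on `(k,ℓ)`-forms: in an orthonormal basis `e` it is the sum over
increasing multi-indices `I`, `J` of `α(e_I)(e_J) β(e_I)(e_J)`; summing over all multi-indices
counts every such term `k! ℓ!` times. -/
def formInner {k ℓ : ℕ} {W : Type*} [NormedAddCommGroup W] [InnerProductSpace ℝ W]
    [FiniteDimensional ℝ W] (α β : Alt k ℓ W) : ℝ :=
  ((k.factorial : ℝ) * (ℓ.factorial : ℝ))⁻¹ *
    ∑ I : Fin k → Fin (Module.finrank ℝ W), ∑ J : Fin ℓ → Fin (Module.finrank ℝ W),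
      α (fun a => stdOrthonormalBasis ℝ W (I a)) (fun b => stdOrthonormalBasis ℝ W (J b)) *
      β (fun a => stdOrthonormalBasis ℝ W (I a)) (fun b => stdOrthonormalBasis ℝ W (J b))

/-- The ambient Euclidean space. Simplices are given by their finite sets of vertices, and the
subsimplices of a simplex by the nonempty subsets of its vertex set. -/
abbrev E (d : ℕ) : Type := EuclideanSpace ℝ (Fin d)

variable {d : ℕ}

/-- The closed simplex with vertex set `σ`, as a set of points. -/
abbrev cell (σ : Finset (E d)) : Set (E d) := convexHull ℝ (σ : Set (E d))

/-- The tangent space of the simplex with vertex set `σ`. -/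
abbrev tangent (σ : Finset (E d)) : Submodule ℝ (E d) := vectorSpan ℝ (σ : Set (E d))

/-- Fields of `(k,ℓ)`-forms on the simplex `σ`: at each point of `σ` a `(k,ℓ)`-form on the tangent
space of `σ`. -/
abbrev FormField (k ℓ : ℕ) (σ : Finset (E d)) : Type := cell σ → Alt k ℓ (tangent σ)

/-- The double trace `ι*ι*` from the simplex `τ` to its subsimplex `σ`. -/
def doubleTrace {k ℓ : ℕ} {σ τ : Finset (E d)} (h : σ ⊆ τ) (ω : FormField k ℓ τ) : FormField k ℓ σ :=
  fun x => pullback (Submodule.inclusion (vectorSpan_mono ℝ (Finset.coe_subset.mpr h)))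
    (ω (Set.inclusion (convexHull_mono (Finset.coe_subset.mpr h)) x))

theorem sub_centroid_mem {σ : Finset (E d)} (x : cell σ) :
    (x : E d) - σ.centroid ℝ id ∈ tangent σ := by
  have hne : σ.Nonempty := by
    have h : (cell σ).Nonempty := ⟨x, x.2⟩
    simpa using convexHull_nonempty_iff.mp h
  have hc : σ.centroid ℝ id ∈ affineSpan ℝ (σ : Set (E d)) :=
    convexHull_subset_affineSpan _ (Finset.centroid_mem_convexHull σ hne)
  have := AffineSubspace.vsub_mem_direction (convexHull_subset_affineSpan _ x.2) hc
  rwa [direction_affineSpan, vsub_eq_sub] at this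

/-- The Euler (position) vector field on the simplex `σ`, with the barycentre of `σ` as origin. -/
def euler (σ : Finset (E d)) (x : cell σ) : tangent σ :=
  ⟨(x : E d) - σ.centroid ℝ id, sub_centroid_mem x⟩

/-- Constant fields of `(k,ℓ)`-forms. -/
def constField (k ℓ : ℕ) (σ : Finset (E d)) : Alt k ℓ (tangent σ) →ₗ[ℝ] FormField k ℓ σ :=
  LinearMap.pi fun _ => LinearMap.id

/-- The Koszul operator (in the first index) on constant `(k+1,ℓ)`-forms:
`(κ b)(x)(v₁,…,v_k) = b(x,v₁,…,v_k)`. -/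
def koszul (k ℓ : ℕ) (σ : Finset (E d)) : Alt (k + 1) ℓ (tangent σ) →ₗ[ℝ] FormField k ℓ σ :=
  LinearMap.pi fun x => (LinearMap.applyₗ (euler σ x)).comp AlternatingMap.curryLeftLinearMap

/-- Whitney `(k,ℓ)`-forms on `σ`: `P⁻Alt^{k,ℓ}(σ) = Alt^{k,ℓ} + κ Alt^{k+1,ℓ}`. This space does not
depend on the origin chosen for the Euler field, since a change of origin changes `κ b` by a
constant field. -/
def whitney (k ℓ : ℕ) (σ : Finset (E d)) : Submodule ℝ (FormField k ℓ σ) :=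
  LinearMap.range (constField k ℓ σ) ⊔ LinearMap.range (koszul k ℓ σ)

/-- The bubble space `B⁻Alt^{k,ℓ}(σ)`: Whitney `(k,ℓ)`-forms on `σ` whose double trace vanishes on
every proper subsimplex of `σ`. -/
def bubble (k ℓ : ℕ) (σ : Finset (E d)) : Submodule ℝ (FormField k ℓ σ) where
  carrier := {ω | ω ∈ whitney k ℓ σ ∧
    ∀ (F : Finset (E d)) (hF : F ⊆ σ), F.Nonempty → F ≠ σ → doubleTrace hF ω = 0}
  zero_mem' := ⟨Submodule.zero_mem _, fun _ _ _ _ => by ext; rfl⟩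
  add_mem' {ω η} hω hη := ⟨Submodule.add_mem _ hω.1 hη.1, fun F hF hne h => by
    have e : doubleTrace hF (ω + η) = doubleTrace hF ω + doubleTrace hF η := by ext; rfl
    rw [e, hω.2 F hF hne h, hη.2 F hF hne h, add_zero]⟩
  smul_mem' c {ω} hω := ⟨Submodule.smul_mem _ c hω.1, fun F hF hne h => by
    have e : doubleTrace hF (c • ω) = c • doubleTrace hF ω := by ext; rfl
    rw [e, hω.2 F hF hne h, smul_zero]⟩

/-- The `L²` inner product of fields on the simplex `σ`, with respect to the Euclidean volume
measure in the dimension `#σ - 1` of `σ` (point evaluation if `σ` is a vertex). -/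
def l2Inner {k ℓ : ℕ} (σ : Finset (E d)) (ω η : FormField k ℓ σ) : ℝ :=
  ∫ x : cell σ, formInner (ω x) (η x) ∂μHE[σ.card - 1]

/-- The degree of freedom `ω ↦ ⟨ι*_σ ι*_σ ω, b⟩_σ` on a simplex `K`, for `σ` a subsimplex of `K`
and `b` a bubble on `σ`. -/
def dof {k ℓ : ℕ} {σ K : Finset (E d)} (h : σ ⊆ K) (b : bubble k ℓ σ) (ω : FormField k ℓ K) : ℝ :=
  l2Inner σ (doubleTrace h ω) b

/-- Unisolvence: any prescription of values for the degrees of freedom (for each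
subsimplex `σ` of `K`, linear in the bubble `b` on `σ`) is attained by exactly one element of the
shape space `P⁻Alt^{k,ℓ}(K)`. -/
def Unisolvent (k ℓ : ℕ) (K : Finset (E d)) : Prop :=
  ∀ g : (σ : Finset (E d)) → Module.Dual ℝ (bubble k ℓ σ),
    ∃! ω : FormField k ℓ K, ω ∈ whitney k ℓ K ∧
      ∀ (σ : Finset (E d)) (h : σ ⊆ K), σ.Nonempty → ∀ b : bubble k ℓ σ, dof h b ω = g σ b

/-- The `n`-dimensional cells of a simplicial complex. -/
abbrev Cells (T : Geometry.SimplicialComplex ℝ (E d)) (n : ℕ) : Type :=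
  {K : Finset (E d) // K ∈ T.faces ∧ K.card = n + 1}

/-- The global finite element space on the triangulation `T`: families of
shape functions on the `n`-cells whose degrees of freedom are single-valued, i.e. agree
on each subsimplex shared by two `n`-cells. -/
def feSpace (n k ℓ : ℕ) (T : Geometry.SimplicialComplex ℝ (E d)) :
    Set ((K : Cells T n) → FormField k ℓ K.1) :=
  {ω | (∀ K, ω K ∈ whitney k ℓ K.1) ∧
    ∀ σ ∈ T.faces, ∀ (K K' : Cells T n) (h : σ ⊆ K.1) (h' : σ ⊆ K'.1) (b : bubble k ℓ σ),
      dof h b (ω K) = dof h' b (ω K')}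

/-- `ι*ι*`-conformity of a piecewise field: the double trace is single-valued on
all subsimplices of the triangulation, of every dimension. -/
def IsConforming {n k ℓ : ℕ} {T : Geometry.SimplicialComplex ℝ (E d)}
    (ω : (K : Cells T n) → FormField k ℓ K.1) : Prop :=
  ∀ σ ∈ T.faces, ∀ (K K' : Cells T n) (h : σ ⊆ K.1) (h' : σ ⊆ K'.1),
    doubleTrace h (ω K) = doubleTrace h' (ω K')

end FormValued

end

noncomputable section

namespace FormValued

/-! Place the simplex at height one in the cone space `E d × ℝ`. Whitney forms on `σ` are exactly
the contractions with `(x, 1)` of alternating `(k+1)`-forms on the cone space (`range_coneField`).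
So the double trace to `F` only restricts the form, and it vanishes iff the form does on all
`(k+1)`-tuples of lifted vertices of `F`, its values being restricted to `tangent F`
(`coneField_eq_zero_iff`).

The main step is to extend a bubble from `σ` to `K` with zero trace on every face not containing `σ`
(`exists_bubble_extension`). Tuples not contained in `σ` get the value zero. For a tuple in `σ`,
pick one of its vertices `c` and pull the `ℓ`-form back along the retraction that sends all vertices
outside `σ` to `c`. If a face `F` contains the tuple but not `σ`, this retraction maps `tangent F`
into `tangent (F ∩ σ)`, where the bubble vanishes because `F ∩ σ` is a proper face.

Since the `L²` product is definite on Whitney forms, functionals on bubbles are represented by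
bubbles. Existence follows by correcting one subsimplex at a time in order of increasing dimension.
Uniqueness is an induction over faces: a form with vanishing degrees of freedom is a bubble
orthogonal to itself. As this uses only faces of `σ`, it also determines traces on `σ`, which is
conformity. -/

variable {d k ℓ : ℕ}

/-! ### Whitney forms as contractions of forms on the cone -/

/-- Alternating `(k+1)`-forms on the cone space `E d × ℝ`, in which `E d` sits as the affine
hyperplane at height one, with values in the alternating `ℓ`-forms on `E d`. -/
abbrev ConeForm (d k ℓ : ℕ) : Type :=
  (E d × ℝ) [⋀^Fin (k + 1)]→ₗ[ℝ] (E d [⋀^Fin ℓ]→ₗ[ℝ] ℝ)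

/-- The lift of a point to height one in the cone space. -/
def lift (x : E d) : E d × ℝ := (x, 1)

/-- The field on `σ` induced by a form on the cone space:
`(x, v, u) ↦ W((x, 1), (v₁, 0), …, (v_k, 0))(u)`. -/
def coneField (σ : Finset (E d)) : ConeForm d k ℓ →ₗ[ℝ] FormField k ℓ σ where
  toFun W := fun x => pullback (tangent σ).subtype
    ((W.curryLeft (lift (x : E d))).compLinearMap (LinearMap.inl ℝ (E d) ℝ))
  map_add' _ _ := rfl
  map_smul' _ _ := rfl

theorem coneField_apply (σ : Finset (E d)) (W : ConeForm d k ℓ) (x : cell σ)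
    (v : Fin k → tangent σ) (u : Fin ℓ → tangent σ) :
    coneField σ W x v u =
      W (Matrix.vecCons (lift (x : E d)) fun a => ((v a : E d), (0 : ℝ))) fun b => (u b : E d) :=
  rfl

theorem doubleTrace_add {σ τ : Finset (E d)} (h : σ ⊆ τ) (ω η : FormField k ℓ τ) :
    doubleTrace h (ω + η) = doubleTrace h ω + doubleTrace h η :=
  rfl

theorem doubleTrace_smul {σ τ : Finset (E d)} (h : σ ⊆ τ) (c : ℝ) (ω : FormField k ℓ τ) :
    doubleTrace h (c • ω) = c • doubleTrace h ω :=
  rfl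

theorem lift_sub_lift (x y : E d) : lift x - lift y = (x - y, (0 : ℝ)) := by
  simp [lift]

/-- Every field induced by a form on the cone space is a Whitney form. -/
theorem coneField_mem_whitney (σ : Finset (E d)) (W : ConeForm d k ℓ) :
    coneField σ W ∈ whitney k ℓ σ := by
  -- Split `(x, 1)` into the lifted barycentre and the horizontal Euler vector: the first gives the
  -- constant part, the second the Koszul part.
  refine Submodule.mem_sup.2 ⟨_, ⟨pullback (tangent σ).subtype
    ((W.curryLeft (lift (σ.centroid ℝ id))).compLinearMap (LinearMap.inl ℝ (E d) ℝ)), rfl⟩,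
    _, ⟨pullback (tangent σ).subtype (W.compLinearMap (LinearMap.inl ℝ (E d) ℝ)), rfl⟩, ?_⟩
  ext x v u
  have hx : lift (x : E d) = lift (σ.centroid ℝ id) + ((euler σ x : E d), (0 : ℝ)) := by
    simp [lift, euler]
  rw [coneField_apply, hx, ← AlternatingMap.curryLeft_apply_apply, map_add]
  simp only [Pi.add_apply, AlternatingMap.add_apply]
  congr 1
  change W _ _ = W _ _
  congr 2
  funext a
  refine Fin.cases ?_ (fun a => ?_) a <;> rfl

/-- Every constant field is induced by a form on the cone space. -/
theorem constField_mem_range_coneField (σ : Finset (E d)) (a : Alt k ℓ (tangent σ)) :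
    constField k ℓ σ a ∈ LinearMap.range (coneField (k := k) (ℓ := ℓ) σ) := by
  let p : E d →ₗ[ℝ] tangent σ := (tangent σ).orthogonalProjectionOnto.toLinearMap
  have hp : ∀ v : tangent σ, p v = v := fun v =>
    Submodule.orthogonalProjectionOnto_mem_subspace_eq_self v
  -- The witness is the wedge of the height functional with `a`, extended by the projection `p`. On
  -- `(x, 1), (v₁, 0), …` only the term with `(x, 1)` in the height slot survives.
  let f : (E d × ℝ) →ₗ[ℝ] (E d × ℝ) [⋀^Fin k]→ₗ[ℝ] (E d [⋀^Fin ℓ]→ₗ[ℝ] ℝ) :=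
    (LinearMap.snd ℝ (E d) ℝ).smulRight
      ((pullback p a).compLinearMap (LinearMap.fst ℝ (E d) ℝ))
  refine ⟨AlternatingMap.alternatizeUncurryFin f, ?_⟩
  ext x v u
  rw [coneField_apply, AlternatingMap.alternatizeUncurryFin_apply, Fin.sum_univ_succ]
  simp only [f, lift, pullback, constField, Fin.val_zero, pow_zero, LinearMap.smulRight_apply,
    LinearMap.snd_apply, Matrix.cons_val_zero, one_smul, Fin.removeNth_zero, Matrix.cons_val_succ,
    zero_smul, AlternatingMap.zero_apply, smul_zero, Finset.sum_const_zero, add_zero]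
  change a (fun i => p (v i)) (fun i => p (u i)) = a v u
  simp only [hp]

/-- The Koszul operator maps constant forms to fields induced by forms on the cone space. -/
theorem koszul_mem_range_coneField (σ : Finset (E d)) (b : Alt (k + 1) ℓ (tangent σ)) :
    koszul k ℓ σ b ∈ LinearMap.range (coneField (k := k) (ℓ := ℓ) σ) := by
  let p : E d →ₗ[ℝ] tangent σ := (tangent σ).orthogonalProjectionOnto.toLinearMap
  have hp : ∀ v : tangent σ, p v = v := fun v =>
    Submodule.orthogonalProjectionOnto_mem_subspace_eq_self v
  -- The projection along the lifted barycentre: `(x, 1)` goes to the Euler vector and `(v, 0)` to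
  -- `v`.
  let g : (E d × ℝ) →ₗ[ℝ] E d :=
    LinearMap.fst ℝ (E d) ℝ - (LinearMap.snd ℝ (E d) ℝ).smulRight (σ.centroid ℝ id)
  refine ⟨(pullback p b).compLinearMap g, ?_⟩
  ext x v u
  rw [coneField_apply]
  have hv : (fun i => p (g (Matrix.vecCons (lift (x : E d))
      (fun a => ((v a : E d), (0 : ℝ))) i))) = Matrix.vecCons (euler σ x) v := by
    funext i
    refine Fin.cases ?_ (fun a => ?_) i
    · rw [← hp (euler σ x)]
      simp [g, lift, euler]
    · simp [g, hp]
  change b _ _ = b _ _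
  congr 1
  · exact congrArg b hv
  · funext i
    exact hp (u i)

theorem range_coneField (σ : Finset (E d)) :
    LinearMap.range (coneField (k := k) (ℓ := ℓ) σ) = whitney k ℓ σ := by
  apply le_antisymm
  · rintro _ ⟨W, rfl⟩
    exact coneField_mem_whitney σ W
  · refine sup_le ?_ ?_
    · rintro _ ⟨a, rfl⟩
      exact constField_mem_range_coneField σ a
    · rintro _ ⟨b, rfl⟩
      exact koszul_mem_range_coneField σ b

/-- The same cone form induces both the field and its trace, so the change of barycentre from `τ` to
`σ` plays no role. -/
theorem doubleTrace_mem_whitney {σ τ : Finset (E d)} (h : σ ⊆ τ) {ω : FormField k ℓ τ}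
    (hω : ω ∈ whitney k ℓ τ) : doubleTrace h ω ∈ whitney k ℓ σ := by
  rw [← range_coneField] at hω
  obtain ⟨W, rfl⟩ := hω
  exact coneField_mem_whitney σ W

/-! ### Values on vertices -/

theorem inl_mem_span_lift {F : Finset (E d)} {v : E d} (hv : v ∈ tangent F) :
    ((v, 0) : E d × ℝ) ∈ Submodule.span ℝ (lift '' (F : Set (E d))) := by
  have : tangent F ≤ (Submodule.span ℝ (lift '' (F : Set (E d)))).comap
      (LinearMap.inl ℝ (E d) ℝ) := by
    refine Submodule.span_le.2 ?_
    rintro _ ⟨x, hx, y, hy, rfl⟩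
    change ((x - y, 0) : E d × ℝ) ∈ Submodule.span ℝ (lift '' (F : Set (E d)))
    rw [← lift_sub_lift]
    exact Submodule.sub_mem _ (Submodule.subset_span ⟨x, hx, rfl⟩)
      (Submodule.subset_span ⟨y, hy, rfl⟩)
  exact this hv

theorem lift_mem_span_lift {F : Finset (E d)} {x : E d} (hx : x ∈ cell F) :
    lift x ∈ Submodule.span ℝ (lift '' (F : Set (E d))) := by
  have hne : F.Nonempty := by
    have h : (cell F).Nonempty := ⟨x, hx⟩
    simpa using convexHull_nonempty_iff.mp h
  obtain ⟨y, hy⟩ := hne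
  have h := AffineSubspace.vsub_mem_direction (convexHull_subset_affineSpan _ hx)
    (subset_affineSpan ℝ (F : Set (E d)) hy)
  rw [direction_affineSpan, vsub_eq_sub] at h
  have := Submodule.add_mem _ (inl_mem_span_lift h)
    (Submodule.subset_span (R := ℝ) (Set.mem_image_of_mem lift hy))
  rwa [← lift_sub_lift, sub_add_cancel] at this

/-- A multilinear map that vanishes on a set in every argument vanishes on its span. -/
theorem multilinear_eq_zero_of_span {m : ℕ} {M N : Type*} [AddCommGroup M] [Module ℝ M]
    [AddCommGroup N] [Module ℝ N] (f : MultilinearMap ℝ (fun _ : Fin m => M) N) (s : Set M)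
    (h : ∀ v, (∀ i, v i ∈ s) → f v = 0) (v : Fin m → M) (hv : ∀ i, v i ∈ Submodule.span ℝ s) :
    f v = 0 := by
  -- `S` is the set of slots already allowed to range over the span; it grows by one slot at a time.
  suffices H : ∀ (S : Finset (Fin m)) (v : Fin m → M), (∀ i ∈ S, v i ∈ Submodule.span ℝ s) →
      (∀ i ∉ S, v i ∈ s) → f v = 0 from H Finset.univ v (fun i _ => hv i) (by simp)
  intro S
  induction S using Finset.induction_on with
  | empty => exact fun v _ hv => h v fun i => hv i (by simp)
  | insert a S ha ih =>
    intro v h1 h2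
    have key : Submodule.span ℝ s ≤ LinearMap.ker (f.toLinearMap v a) := by
      refine Submodule.span_le.2 fun y hy => ?_
      refine ih (Function.update v a y) (fun i hi => ?_) (fun i hi => ?_)
      · rw [Function.update_of_ne (by rintro rfl; exact ha hi)]
        exact h1 i (Finset.mem_insert_of_mem hi)
      · by_cases hia : i = a
        · subst hia; simpa using hy
        · rw [Function.update_of_ne hia]
          exact h2 i (by simp [hia, hi])
    have := key (h1 a (Finset.mem_insert_self a S))
    simpa using this

/-- Subtracting the first argument of an alternating form from all others does not affect its
vanishing. -/
theorem alternating_eq_zero_of_differences {m : ℕ} {M N : Type*} [AddCommGroup M] [Module ℝ M]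
    [AddCommGroup N] [Module ℝ N] (f : M [⋀^Fin (m + 1)]→ₗ[ℝ] N) (v : Fin (m + 1) → M)
    (h : f (Matrix.vecCons (v 0) fun a => v a.succ - v 0) = 0) : f v = 0 := by
  suffices H : ∀ S : Finset (Fin m),
      f (Matrix.vecCons (v 0) fun a => if a ∈ S then v a.succ - v 0 else v a.succ) = f v by
    rw [← H Finset.univ]
    simpa using h
  intro S
  induction S using Finset.induction_on with
  | empty =>
    congr 1
    funext i
    refine Fin.cases ?_ (fun a => ?_) i <;> simp
  | insert a S ha ih =>
    rw [← ih]
    set w : Fin (m + 1) → M :=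
      Matrix.vecCons (v 0) fun a => if a ∈ S then v a.succ - v 0 else v a.succ with hw
    have e : (Matrix.vecCons (v 0) fun b => if b ∈ insert a S then v b.succ - v 0 else v b.succ)
        = Function.update w a.succ (w a.succ - w 0) := by
      funext i
      refine Fin.cases ?_ (fun b => ?_) i
      · rw [Function.update_of_ne (Fin.succ_ne_zero a).symm]; simp [hw]
      · by_cases hb : b = a
        · subst hb; simp [hw, ha]
        · rw [Function.update_of_ne (by simpa using hb)]; simp [hw, hb]
    -- The subtracted term has `v 0` in two slots.
    rw [e, AlternatingMap.map_update_sub, Function.update_eq_self,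
      AlternatingMap.map_update_self _ _ (Fin.succ_ne_zero a), sub_zero]

/-- The field induced on `F` vanishes iff the form vanishes on the lifted vertices of `F`. -/
theorem coneField_eq_zero_iff (F : Finset (E d)) (W : ConeForm d k ℓ) :
    coneField F W = 0 ↔ ∀ (i : Fin (k + 1) → E d), (∀ a, i a ∈ F) → ∀ u : Fin ℓ → E d,
      (∀ b, u b ∈ tangent F) → W (fun a => lift (i a)) u = 0 := by
  constructor
  · intro h i hi u hu
    let Wu : (E d × ℝ) [⋀^Fin (k + 1)]→ₗ[ℝ] ℝ :=
      (LinearMap.mk ⟨fun α : E d [⋀^Fin ℓ]→ₗ[ℝ] ℝ => α u, fun _ _ => rfl⟩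
        (fun _ _ => rfl)).compAlternatingMap W
    refine alternating_eq_zero_of_differences Wu (fun a => lift (i a)) ?_
    -- Evaluate the field at the vertex `i 0`, on the edge vectors issuing from it.
    have h1 := congrFun h ⟨i 0, subset_convexHull ℝ _ (hi 0)⟩
    have h2 := congrArg (fun α : Alt k ℓ (tangent F) => α
      (fun a => ⟨i a.succ - i 0, vsub_mem_vectorSpan ℝ (hi a.succ) (hi 0)⟩)
      (fun b => ⟨u b, hu b⟩)) h1
    simp only [coneField_apply] at h2
    simp only [lift_sub_lift]
    exact h2
  · intro h
    ext x v u
    rw [coneField_apply]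
    let Wu : (E d × ℝ) [⋀^Fin (k + 1)]→ₗ[ℝ] ℝ :=
      (LinearMap.mk ⟨fun α : E d [⋀^Fin ℓ]→ₗ[ℝ] ℝ => α fun b => (u b : E d), fun _ _ => rfl⟩
        (fun _ _ => rfl)).compAlternatingMap W
    refine multilinear_eq_zero_of_span Wu.toMultilinearMap (lift '' (F : Set (E d)))
      (fun v hv => ?_) _ (fun i => ?_)
    · choose i hi hiv using hv
      obtain rfl : (fun a => lift (i a)) = v := funext hiv
      exact h i hi _ fun b => (u b).2
    · refine Fin.cases ?_ (fun a => ?_) i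
      · exact lift_mem_span_lift x.2
      · exact inl_mem_span_lift (v a).2

/-! ### Extension of bubbles -/

/-- The height coordinate of a linear relation says that its weights sum to zero, so it is an affine
relation. -/
theorem linearIndependent_lift {K : Finset (E d)}
    (hK : AffineIndependent ℝ ((↑) : K → E d)) :
    LinearIndependent ℝ fun x : K => lift (x : E d) := by
  rw [Fintype.linearIndependent_iff]
  intro w hw
  have h1 := congrArg Prod.fst hw
  have h2 := congrArg Prod.snd hw
  simp only [lift, Prod.smul_mk, Prod.fst_sum, Prod.snd_sum, smul_eq_mul, mul_one, Prod.fst_zero,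
    Prod.snd_zero] at h1 h2
  exact fun i => (affineIndependent_iff.1 hK) Finset.univ w h2 h1 i (Finset.mem_univ i)

/-- Linear endomorphisms of the cone space can be prescribed on the lifted vertices. -/
theorem exists_linearMap_lift {K : Finset (E d)}
    (hK : AffineIndependent ℝ ((↑) : K → E d)) (f : E d → E d × ℝ) :
    ∃ L : (E d × ℝ) →ₗ[ℝ] (E d × ℝ), ∀ x ∈ K, L (lift x) = f x := by
  let B := Module.Basis.span (linearIndependent_lift hK)
  obtain ⟨L, hL⟩ := LinearMap.exists_extend (B.constr ℝ fun x : K => f x)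
  refine ⟨L, fun x hx => ?_⟩
  have h := LinearMap.congr_fun hL (B ⟨x, hx⟩)
  rw [Module.Basis.constr_basis, LinearMap.comp_apply, Submodule.subtype_apply,
    Module.Basis.span_apply] at h
  exact h

open Classical in
/-- A retraction of the tangent spaces of the faces `F ∋ c` of `K` onto those of `F ∩ σ`. -/
theorem exists_retraction {K : Finset (E d)} (hK : AffineIndependent ℝ ((↑) : K → E d))
    (σ : Finset (E d)) (c : E d) :
    ∃ r : E d →ₗ[ℝ] E d, ∀ F ⊆ K, c ∈ F → c ∈ σ → (∀ u ∈ tangent F, r u ∈ tangent (F ∩ σ)) ∧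
      (F ⊆ σ → ∀ u ∈ tangent F, r u = u) := by
  -- `L` fixes the lifted vertices of `σ` and collapses the other vertices of `K` to `c`; `r` is its
  -- horizontal part.
  obtain ⟨L, hL⟩ := exists_linearMap_lift hK fun x => lift (if x ∈ σ then x else c)
  refine ⟨LinearMap.fst ℝ (E d) ℝ ∘ₗ L ∘ₗ LinearMap.inl ℝ (E d) ℝ, fun F hF hcF hcσ => ?_⟩
  have key : ∀ x ∈ F, ∀ y ∈ F, (LinearMap.fst ℝ (E d) ℝ ∘ₗ L ∘ₗ LinearMap.inl ℝ (E d) ℝ) (x - y) =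
      (if x ∈ σ then x else c) - (if y ∈ σ then y else c) := by
    intro x hx y hy
    change (L (x - y, 0)).1 = _
    rw [← lift_sub_lift, map_sub, hL x (hF hx), hL y (hF hy), lift_sub_lift]
  constructor
  · have : tangent F ≤ (tangent (F ∩ σ)).comap
        (LinearMap.fst ℝ (E d) ℝ ∘ₗ L ∘ₗ LinearMap.inl ℝ (E d) ℝ) := by
      refine Submodule.span_le.2 ?_
      rintro _ ⟨x, hx, y, hy, rfl⟩
      change (LinearMap.fst ℝ (E d) ℝ ∘ₗ L ∘ₗ LinearMap.inl ℝ (E d) ℝ) (x - y) ∈ tangent (F ∩ σ)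
      rw [key x hx y hy]
      have hm : ∀ z ∈ F, (if z ∈ σ then z else c) ∈ ((F ∩ σ : Finset (E d)) : Set (E d)) := by
        intro z hz
        split_ifs with h
        · simpa using ⟨hz, h⟩
        · simpa using ⟨hcF, hcσ⟩
      exact vsub_mem_vectorSpan ℝ (hm x hx) (hm y hy)
    exact this
  · intro hFσ
    have : tangent F ≤ LinearMap.eqLocus
        (LinearMap.fst ℝ (E d) ℝ ∘ₗ L ∘ₗ LinearMap.inl ℝ (E d) ℝ) LinearMap.id := by
      refine Submodule.span_le.2 ?_
      rintro _ ⟨x, hx, y, hy, rfl⟩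
      change (LinearMap.fst ℝ (E d) ℝ ∘ₗ L ∘ₗ LinearMap.inl ℝ (E d) ℝ) (x - y) = x - y
      rw [key x hx y hy, if_pos (hFσ hx), if_pos (hFσ hy)]
    exact this

open Classical in
/-- Extension of a bubble on `σ` to the simplex `K`, restricted to the part that involves
the vertices in `S`. -/
theorem exists_partial_extension {K σ : Finset (E d)}
    (hK : AffineIndependent ℝ ((↑) : K → E d)) (hσ : σ ⊆ K) (W : ConeForm d k ℓ)
    (hW : ∀ F ⊆ σ, F ≠ σ → coneField F W = 0) (S : Finset (E d)) (hS : S ⊆ σ) :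
    ∃ W' : ConeForm d k ℓ, (∀ F ⊆ K, ¬ σ ⊆ F → coneField F W' = 0) ∧
      ∀ i : Fin (k + 1) → E d, (∀ a, i a ∈ σ) → ∀ u : Fin ℓ → E d, (∀ b, u b ∈ tangent σ) →
        W' (fun a => lift (i a)) u =
          if ∃ a, i a ∈ S then W (fun a => lift (i a)) u else 0 := by
  -- On the lifted vertices of `K`, `A S` keeps those in `σ \ S` and kills the rest.
  have hA : ∀ S : Finset (E d), ∃ L : (E d × ℝ) →ₗ[ℝ] (E d × ℝ), ∀ x ∈ K,
      L (lift x) = if x ∈ σ ∧ x ∉ S then lift x else 0 := fun S =>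
    exists_linearMap_lift hK fun x => if x ∈ σ ∧ x ∉ S then lift x else 0
  choose A hA using hA
  have hA' : ∀ (S : Finset (E d)) (i : Fin (k + 1) → E d), (∀ a, i a ∈ K) → ∀ u,
      W (fun a => A S (lift (i a))) u =
        if ∃ a, i a ∉ σ ∨ i a ∈ S then 0 else W (fun a => lift (i a)) u := by
    intro S i hi u
    split_ifs with h
    · obtain ⟨a, ha⟩ := h
      rw [W.map_coord_zero a (by rw [hA S _ (hi a), if_neg (by tauto)])]
      rfl
    · push Not at h
      congr 2
      funext a
      rw [hA S _ (hi a), if_pos (h a)]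
  induction S using Finset.induction_on with
  | empty => exact ⟨0, fun F _ _ => map_zero _, by simp⟩
  | insert c S hcS ih =>
    obtain ⟨W', h1, h2⟩ := ih fun x hx => hS (Finset.mem_insert_of_mem hx)
    have hcσ : c ∈ σ := hS (Finset.mem_insert_self c S)
    obtain ⟨r, hr⟩ := exists_retraction hK σ c
    -- The difference isolates the tuples in `σ \ S` that contain `c`. Each tuple is thus handled
    -- once, at its first inserted vertex, which keeps the choice of `c` compatible with
    -- alternation.
    let U : ConeForm d k ℓ := (pullbackₗ ℓ r).compAlternatingMap
      (W.compLinearMap (A S) - W.compLinearMap (A (insert c S)))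
    have hU : ∀ i : Fin (k + 1) → E d, ∀ u, U (fun a => lift (i a)) u =
        W (fun a => A S (lift (i a))) (fun b => r (u b)) -
        W (fun a => A (insert c S) (lift (i a))) (fun b => r (u b)) := fun _ _ => rfl
    refine ⟨W' + U, fun F hF hσF => ?_, fun i hi u hu => ?_⟩
    · rw [map_add, h1 F hF hσF, zero_add, coneField_eq_zero_iff]
      intro i hi u hu
      rw [hU, hA' _ _ (fun a => hF (hi a)), hA' _ _ (fun a => hF (hi a))]
      by_cases hcF : c ∈ F
      · have hz : (∀ a, i a ∈ σ) → W (fun a => lift (i a)) (fun b => r (u b)) = 0 := by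
          intro hiσ
          refine (coneField_eq_zero_iff (F ∩ σ) W).1
            (hW _ Finset.inter_subset_right fun h => hσF ?_) i
            (fun a => Finset.mem_inter.2 ⟨hi a, hiσ a⟩) _ fun b => (hr F hF hcF hcσ).1 _ (hu b)
          rw [← h]
          exact Finset.inter_subset_left
        by_cases hiσ : ∀ a, i a ∈ σ
        · simp [hz hiσ]
        · push Not at hiσ
          obtain ⟨a, ha⟩ := hiσ
          rw [if_pos ⟨a, Or.inl ha⟩, if_pos ⟨a, Or.inl ha⟩, sub_zero]
      -- Without `c` in the tuple, the two terms of `U` coincide.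
      · have : ∀ a, i a ≠ c := fun a h => hcF (h ▸ hi a)
        simp [this]
    · have hru : (fun b => r (u b)) = u :=
        funext fun b => (hr σ hσ hcσ hcσ).2 subset_rfl _ (hu b)
      rw [AlternatingMap.add_apply, AlternatingMap.add_apply, h2 i hi u hu, hU, hru,
        hA' _ _ (fun a => hσ (hi a)), hA' _ _ (fun a => hσ (hi a))]
      simp only [hi, not_true_eq_false, false_or]
      by_cases hS' : ∃ a, i a ∈ S
      · obtain ⟨a, ha⟩ := hS'
        rw [if_pos ⟨a, ha⟩, if_pos ⟨a, ha⟩, if_pos ⟨a, Finset.mem_insert_of_mem ha⟩,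
          if_pos ⟨a, Finset.mem_insert_of_mem ha⟩]
        simp
      · rw [if_neg hS', if_neg hS']
        split_ifs <;> simp

/-- A bubble on `σ` extends to a Whitney form on `K` whose double trace vanishes on all
subsimplices that do not contain `σ`. -/
theorem exists_bubble_extension {K σ : Finset (E d)}
    (hK : AffineIndependent ℝ ((↑) : K → E d)) (hσ : σ ⊆ K)
    (b : bubble k ℓ σ) :
    ∃ ω ∈ whitney k ℓ K, doubleTrace hσ ω = b ∧
      ∀ (F : Finset (E d)) (hF : F ⊆ K), ¬ σ ⊆ F → doubleTrace hF ω = 0 := by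
  obtain ⟨b, hb, hb0⟩ := b
  rw [← range_coneField] at hb
  obtain ⟨W, rfl⟩ := hb
  have hW : ∀ F ⊆ σ, F ≠ σ → coneField F W = 0 := by
    intro F hF hFσ
    rcases F.eq_empty_or_nonempty with rfl | hFne
    -- There are `k + 1 ≥ 1` vertex slots, so the empty face admits no tuple.
    · rw [coneField_eq_zero_iff]
      exact fun i hi => absurd (hi 0) (Finset.notMem_empty _)
    · exact hb0 F hF hFne hFσ
  obtain ⟨W', h1, h2⟩ := exists_partial_extension hK hσ W hW σ subset_rfl
  refine ⟨coneField K W', coneField_mem_whitney K W', ?_, fun F hF hσF => h1 F hF hσF⟩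
  change coneField σ W' = coneField σ W
  suffices h : coneField σ (W' - W) = 0 by
    rw [← sub_add_cancel W' W, map_add, h, zero_add]
  rw [coneField_eq_zero_iff]
  intro i hi u hu
  rw [AlternatingMap.sub_apply, AlternatingMap.sub_apply, h2 i hi u hu, if_pos ⟨0, hi 0⟩, sub_self]

/-! ### The volume measure of a simplex -/

/-- Transports the Hausdorff measure of the cell to the tangent space, whose dimension is `σ.card -
1`. -/
theorem isometry_euler (σ : Finset (E d)) : Isometry (euler σ) := by
  refine Isometry.of_dist_eq fun x y => ?_
  rw [Subtype.dist_eq, Subtype.dist_eq]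
  exact dist_sub_right _ _ _

theorem compactSpace_cell (σ : Finset (E d)) : CompactSpace (cell σ) :=
  isCompact_iff_compactSpace.1 (σ.finite_toSet.isCompact_convexHull ℝ)

theorem convex_range_euler (σ : Finset (E d)) : Convex ℝ (Set.range (euler σ)) := by
  rintro _ ⟨x, rfl⟩ _ ⟨y, rfl⟩ a b ha hb hab
  refine ⟨⟨a • (x : E d) + b • (y : E d), convex_convexHull ℝ _ x.2 y.2 ha hb hab⟩, ?_⟩
  apply Subtype.ext
  obtain rfl : b = 1 - a := by linarith
  simp only [euler, Submodule.coe_add, Submodule.coe_smul]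
  module

theorem interior_range_euler_nonempty {σ : Finset (E d)} (hσ : σ.Nonempty) :
    (interior (Set.range (euler σ))).Nonempty := by
  obtain ⟨x₀, hx₀⟩ := hσ
  have hne : (Set.range (euler σ)).Nonempty := ⟨_, ⟨x₀, subset_convexHull ℝ _ hx₀⟩, rfl⟩
  rw [(convex_range_euler σ).interior_nonempty_iff_affineSpan_eq_top,
    AffineSubspace.affineSpan_eq_top_iff_vectorSpan_eq_top_of_nonempty ℝ _ _ hne, eq_top_iff]
  have key : tangent σ ≤ (vectorSpan ℝ (Set.range (euler σ))).map (tangent σ).subtype := by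
    refine Submodule.span_le.2 ?_
    rintro _ ⟨x, hx, y, hy, rfl⟩
    refine ⟨euler σ ⟨x, subset_convexHull ℝ _ hx⟩ - euler σ ⟨y, subset_convexHull ℝ _ hy⟩,
      vsub_mem_vectorSpan ℝ ⟨_, rfl⟩ ⟨_, rfl⟩, ?_⟩
    simp [euler]
  intro v _
  obtain ⟨w, hw, hwv⟩ := key v.2
  rwa [← Subtype.ext (a1 := w) (a2 := v) hwv]

theorem finrank_tangent {σ : Finset (E d)} (hσ : AffineIndependent ℝ ((↑) : σ → E d))
    (hne : σ.Nonempty) : Module.finrank ℝ (tangent σ) = σ.card - 1 := by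
  have h := hσ.finrank_vectorSpan (n := σ.card - 1) (by
    have := hne.card_pos
    rw [Fintype.card_coe]
    omega)
  have hr : Set.range ((↑) : σ → E d) = σ := Subtype.range_coe
  exact (LinearEquiv.ofEq _ _ (congrArg (vectorSpan ℝ) hr)).finrank_eq.symm.trans h

theorem isFiniteMeasure_cell {σ : Finset (E d)} (hσ : AffineIndependent ℝ ((↑) : σ → E d))
    (hne : σ.Nonempty) :
    MeasureTheory.IsFiniteMeasure (μHE[σ.card - 1] : MeasureTheory.Measure (cell σ)) := by
  have := compactSpace_cell σ
  refine ⟨?_⟩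
  rw [← (isometry_euler σ).euclideanHausdorffMeasure_image, ← finrank_tangent hσ hne]
  exact (isCompact_univ.image (isometry_euler σ).continuous).measure_lt_top

theorem isOpenPosMeasure_cell {σ : Finset (E d)} (hσ : AffineIndependent ℝ ((↑) : σ → E d))
    (hne : σ.Nonempty) :
    (μHE[σ.card - 1] : MeasureTheory.Measure (cell σ)).IsOpenPosMeasure := by
  refine ⟨fun U hU hUne => ?_⟩
  obtain ⟨O, hO, rfl⟩ := (isometry_euler σ).isEmbedding.isInducing.isOpen_iff.1 hU
  rw [(isometry_euler σ).euclideanHausdorffMeasure_preimage, ← finrank_tangent hσ hne]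
  obtain ⟨x, hx⟩ := hUne
  -- `x` may lie on the boundary of the cell, but by convexity every neighbourhood of it meets the
  -- interior.
  have hcl : euler σ x ∈ closure (interior (Set.range (euler σ))) := by
    rw [(convex_range_euler σ).closure_interior_eq_closure_of_nonempty_interior
      (interior_range_euler_nonempty hne)]
    exact subset_closure ⟨x, rfl⟩
  have hpos := (hO.inter isOpen_interior).measure_pos
    (μHE[Module.finrank ℝ (tangent σ)] : MeasureTheory.Measure (tangent σ))
    (mem_closure_iff.1 hcl O hO hx)
  exact (hpos.trans_le
    (MeasureTheory.measure_mono (Set.inter_subset_inter_right O interior_subset))).ne'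

/-! ### The inner products -/

section formInner

variable {V : Type*} [NormedAddCommGroup V] [InnerProductSpace ℝ V] [FiniteDimensional ℝ V]

theorem formInner_comm (α β : Alt k ℓ V) : formInner α β = formInner β α := by
  simp only [formInner, mul_comm]

theorem formInner_add_left (α α' β : Alt k ℓ V) :
    formInner (α + α') β = formInner α β + formInner α' β := by
  simp only [formInner, AlternatingMap.add_apply, add_mul, Finset.sum_add_distrib, mul_add]

theorem formInner_smul_left (c : ℝ) (α β : Alt k ℓ V) :
    formInner (c • α) β = c * formInner α β := by
  simp only [formInner, AlternatingMap.smul_apply, smul_eq_mul, Finset.mul_sum]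
  refine Finset.sum_congr rfl fun I _ => Finset.sum_congr rfl fun J _ => ?_
  ring

theorem formInner_self_nonneg (α : Alt k ℓ V) : 0 ≤ formInner α α :=
  mul_nonneg (by positivity)
    (Finset.sum_nonneg fun _ _ => Finset.sum_nonneg fun _ _ => mul_self_nonneg _)

theorem formInner_self_eq_zero {α : Alt k ℓ V} (h : formInner α α = 0) : α = 0 := by
  have hc : ((k.factorial : ℝ) * (ℓ.factorial : ℝ))⁻¹ ≠ 0 := by positivity
  have h := (mul_eq_zero.1 h).resolve_left hc
  rw [Finset.sum_eq_zero_iff_of_nonneg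
    fun _ _ => Finset.sum_nonneg fun _ _ => mul_self_nonneg _] at h
  refine Module.Basis.ext_alternating (stdOrthonormalBasis ℝ V).toBasis fun I _ => ?_
  refine Module.Basis.ext_alternating (stdOrthonormalBasis ℝ V).toBasis fun J _ => ?_
  have h' := h I (Finset.mem_univ I)
  rw [Finset.sum_eq_zero_iff_of_nonneg fun _ _ => mul_self_nonneg _] at h'
  simpa using h' J (Finset.mem_univ J)

end formInner

/-! ### Continuity and definiteness of the `L²` inner product -/

theorem continuous_coneField_apply (σ : Finset (E d)) (W : ConeForm d k ℓ)
    (v : Fin k → tangent σ) (u : Fin ℓ → tangent σ) :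
    Continuous fun x : cell σ => coneField σ W x v u := by
  let f : (E d × ℝ) →ₗ[ℝ] ℝ :=
    { toFun := fun p => W.curryLeft p (fun a => ((v a : E d), (0 : ℝ))) fun b => (u b : E d)
      map_add' := fun p q => by rw [map_add]; rfl
      map_smul' := fun c p => by rw [map_smul]; rfl }
  have hl : Continuous fun x : cell σ => lift (x : E d) := by
    unfold lift
    fun_prop
  exact f.continuous_of_finiteDimensional.comp hl

theorem continuous_formInner {σ : Finset (E d)} {ω η : FormField k ℓ σ}
    (hω : ω ∈ whitney k ℓ σ) (hη : η ∈ whitney k ℓ σ) :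
    Continuous fun x => formInner (ω x) (η x) := by
  rw [← range_coneField] at hω hη
  obtain ⟨W, rfl⟩ := hω
  obtain ⟨W', rfl⟩ := hη
  unfold formInner
  refine continuous_const.mul (continuous_finsetSum _ fun I _ => continuous_finsetSum _ fun J _ => ?_)
  exact (continuous_coneField_apply σ W _ _).mul (continuous_coneField_apply σ W' _ _)

theorem integrable_formInner {σ : Finset (E d)} (hσ : AffineIndependent ℝ ((↑) : σ → E d))
    (hne : σ.Nonempty) {ω η : FormField k ℓ σ}
    (hω : ω ∈ whitney k ℓ σ) (hη : η ∈ whitney k ℓ σ) :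
    MeasureTheory.Integrable (fun x => formInner (ω x) (η x)) μHE[σ.card - 1] := by
  have := compactSpace_cell σ
  have := isFiniteMeasure_cell hσ hne
  exact (continuous_formInner hω hη).integrable_of_hasCompactSupport
    (HasCompactSupport.of_compactSpace _)

theorem l2Inner_comm (σ : Finset (E d)) (ω η : FormField k ℓ σ) :
    l2Inner σ ω η = l2Inner σ η ω := by
  simp only [l2Inner, formInner_comm]

theorem l2Inner_smul_left (σ : Finset (E d)) (c : ℝ) (ω η : FormField k ℓ σ) :
    l2Inner σ (c • ω) η = c * l2Inner σ ω η := by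
  simp only [l2Inner, Pi.smul_apply, formInner_smul_left, MeasureTheory.integral_const_mul]

theorem l2Inner_add_left {σ : Finset (E d)} (hσ : AffineIndependent ℝ ((↑) : σ → E d))
    (hne : σ.Nonempty) {ω ω' η : FormField k ℓ σ} (hω : ω ∈ whitney k ℓ σ)
    (hω' : ω' ∈ whitney k ℓ σ) (hη : η ∈ whitney k ℓ σ) :
    l2Inner σ (ω + ω') η = l2Inner σ ω η + l2Inner σ ω' η := by
  simp only [l2Inner, Pi.add_apply, formInner_add_left]
  exact MeasureTheory.integral_add (integrable_formInner hσ hne hω hη)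
    (integrable_formInner hσ hne hω' hη)

theorem l2Inner_self_eq_zero {σ : Finset (E d)} (hσ : AffineIndependent ℝ ((↑) : σ → E d))
    (hne : σ.Nonempty) {ω : FormField k ℓ σ} (hω : ω ∈ whitney k ℓ σ)
    (h : l2Inner σ ω ω = 0) : ω = 0 := by
  have := isOpenPosMeasure_cell hσ hne
  rw [l2Inner, MeasureTheory.integral_eq_zero_iff_of_nonneg (fun x => formInner_self_nonneg _)
    (integrable_formInner hσ hne hω hω)] at h
  have h' := MeasureTheory.Measure.eq_of_ae_eq h (continuous_formInner hω hω) continuous_zero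
  exact funext fun x => formInner_self_eq_zero (congrFun h' x)

theorem l2Inner_add_right {σ : Finset (E d)} (hσ : AffineIndependent ℝ ((↑) : σ → E d))
    (hne : σ.Nonempty) {ω η η' : FormField k ℓ σ} (hω : ω ∈ whitney k ℓ σ)
    (hη : η ∈ whitney k ℓ σ) (hη' : η' ∈ whitney k ℓ σ) :
    l2Inner σ ω (η + η') = l2Inner σ ω η + l2Inner σ ω η' := by
  rw [l2Inner_comm, l2Inner_add_left hσ hne hη hη' hω, l2Inner_comm σ η, l2Inner_comm σ η']

theorem l2Inner_smul_right (σ : Finset (E d)) (c : ℝ) (ω η : FormField k ℓ σ) :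
    l2Inner σ ω (c • η) = c * l2Inner σ ω η := by
  rw [l2Inner_comm, l2Inner_smul_left, l2Inner_comm]

/-! ### Representation of functionals on bubbles -/

/-- The functional `b ↦ ⟨ω, b⟩_σ` on bubbles given by a Whitney form `ω`. -/
def l2Functional {σ : Finset (E d)} (hσ : AffineIndependent ℝ ((↑) : σ → E d))
    (hne : σ.Nonempty) {ω : FormField k ℓ σ} (hω : ω ∈ whitney k ℓ σ) :
    Module.Dual ℝ (bubble k ℓ σ) where
  toFun b := l2Inner σ ω b
  map_add' b b' := l2Inner_add_right hσ hne hω b.2.1 b'.2.1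
  map_smul' c b := l2Inner_smul_right σ c ω b

theorem l2Functional_apply {σ : Finset (E d)} (hσ : AffineIndependent ℝ ((↑) : σ → E d))
    (hne : σ.Nonempty) {ω : FormField k ℓ σ} (hω : ω ∈ whitney k ℓ σ) (b : bubble k ℓ σ) :
    l2Functional hσ hne hω b = l2Inner σ ω b :=
  rfl

theorem bubble_le_whitney (k ℓ : ℕ) (σ : Finset (E d)) : bubble k ℓ σ ≤ whitney k ℓ σ :=
  fun _ h => h.1

theorem finiteDimensional_alternatingMap (m : ℕ) (M N : Type*) [AddCommGroup M] [Module ℝ M]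
    [FiniteDimensional ℝ M] [AddCommGroup N] [Module ℝ N] [FiniteDimensional ℝ N] :
    FiniteDimensional ℝ (M [⋀^Fin m]→ₗ[ℝ] N) :=
  Module.Finite.of_injective (AlternatingMap.toMultilinearMapLM (S := ℝ))
    AlternatingMap.coe_multilinearMap_injective

theorem finite_of_submodule_le {M : Type*} [AddCommMonoid M] [Module ℝ M] {p q : Submodule ℝ M}
    (h : p ≤ q) [Module.Finite ℝ q] : Module.Finite ℝ p := by
  let _ := Module.addCommMonoidToAddCommGroup ℝ (M := M)
  exact Submodule.finiteDimensional_of_le h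

theorem finite_bubble (k ℓ : ℕ) (σ : Finset (E d)) : Module.Finite ℝ (bubble k ℓ σ) := by
  have := finiteDimensional_alternatingMap ℓ (E d) ℝ
  have := finiteDimensional_alternatingMap (k + 1) (E d × ℝ) (E d [⋀^Fin ℓ]→ₗ[ℝ] ℝ)
  have : Module.Finite ℝ (LinearMap.range (coneField (k := k) (ℓ := ℓ) σ)) :=
    Module.Finite.range _
  exact finite_of_submodule_le ((range_coneField σ).symm ▸ bubble_le_whitney k ℓ σ)

/-- A definite bilinear form on a finite-dimensional space represents every functional. -/
theorem surjective_of_definite {V : Type*} [AddCommMonoid V] [Module ℝ V] [Module.Finite ℝ V]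
    (B : V →ₗ[ℝ] Module.Dual ℝ V) (hB : ∀ v, B v v = 0 → v = 0) : Function.Surjective B := by
  let _ := Module.addCommMonoidToAddCommGroup ℝ (M := V)
  have hinj : Function.Injective B := by
    rw [← LinearMap.ker_eq_bot, LinearMap.ker_eq_bot']
    intro b hb
    exact hB b (LinearMap.congr_fun hb b)
  exact (LinearMap.injective_iff_surjective_of_finrank_eq_finrank
    (Subspace.dual_finrank_eq (K := ℝ)).symm).1 hinj

/-- Functionals on bubbles are represented by bubbles. -/
theorem exists_bubble_l2Inner_eq {σ : Finset (E d)}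
    (hσ : AffineIndependent ℝ ((↑) : σ → E d)) (hne : σ.Nonempty)
    (g : Module.Dual ℝ (bubble k ℓ σ)) :
    ∃ b : bubble k ℓ σ, ∀ b' : bubble k ℓ σ, l2Inner σ (b : FormField k ℓ σ) b' = g b' := by
  have := finite_bubble k ℓ σ
  let B : bubble k ℓ σ →ₗ[ℝ] Module.Dual ℝ (bubble k ℓ σ) :=
    { toFun := fun b => l2Functional hσ hne b.2.1
      map_add' := fun b b' => by
        ext c
        rw [LinearMap.add_apply, l2Functional_apply, l2Functional_apply, l2Functional_apply,
          ← l2Inner_add_left hσ hne b.2.1 b'.2.1 c.2.1]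
        rfl
      map_smul' := fun t b => by
        ext c
        rw [LinearMap.smul_apply, l2Functional_apply, l2Functional_apply, RingHom.id_apply,
          smul_eq_mul, ← l2Inner_smul_left]
        rfl }
  obtain ⟨b, hb⟩ := surjective_of_definite B
    (fun b hb => Subtype.ext (l2Inner_self_eq_zero hσ hne b.2.1 hb)) g
  exact ⟨b, fun b' => LinearMap.congr_fun hb b'⟩

/-! ### Unisolvence and conformity -/

theorem affineIndependent_of_subset {σ K : Finset (E d)} (h : σ ⊆ K)
    (hK : AffineIndependent ℝ ((↑) : K → E d)) : AffineIndependent ℝ ((↑) : σ → E d) :=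
  AffineIndependent.mono (t := (K : Set (E d))) hK (Finset.coe_subset.2 h)

/-- A Whitney form on `σ` is zero if all its degrees of freedom on the subsimplices vanish. -/
theorem eq_zero_of_l2Inner_eq_zero (σ : Finset (E d))
    (hσ : AffineIndependent ℝ ((↑) : σ → E d)) (hne : σ.Nonempty) (ω : FormField k ℓ σ)
    (hω : ω ∈ whitney k ℓ σ)
    (h : ∀ (F : Finset (E d)) (hF : F ⊆ σ), F.Nonempty → ∀ b : bubble k ℓ F,
      l2Inner F (doubleTrace hF ω) b = 0) : ω = 0 := by
  induction σ using Finset.strongInduction with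
  | H σ ih =>
    -- By induction all proper traces vanish, so `ω` may be tested against itself.
    have hb : ω ∈ bubble k ℓ σ := ⟨hω, fun F hF hFne hFσ =>
      ih F (hF.ssubset_of_ne hFσ) (affineIndependent_of_subset hF hσ) hFne _
        (doubleTrace_mem_whitney hF hω) fun G hG hGne b => h G (hG.trans hF) hGne b⟩
    exact l2Inner_self_eq_zero hσ hne hω (h σ subset_rfl hne ⟨ω, hb⟩)

/-- Whitney forms on `σ` with the same degrees of freedom on all subsimplices are equal. -/
theorem eq_of_l2Inner_eq {σ : Finset (E d)}
    (hσ : AffineIndependent ℝ ((↑) : σ → E d)) (hne : σ.Nonempty) {ω η : FormField k ℓ σ}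
    (hω : ω ∈ whitney k ℓ σ) (hη : η ∈ whitney k ℓ σ)
    (h : ∀ (F : Finset (E d)) (hF : F ⊆ σ), F.Nonempty → ∀ b : bubble k ℓ F,
      l2Inner F (doubleTrace hF ω) b = l2Inner F (doubleTrace hF η) b) : ω = η := by
  have h0 : ω + (-1 : ℝ) • η = 0 := by
    refine eq_zero_of_l2Inner_eq_zero σ hσ hne _
      (Submodule.add_mem _ hω (Submodule.smul_mem _ _ hη)) fun F hF hFne b => ?_
    have hη' := doubleTrace_mem_whitney hF hη
    rw [doubleTrace_add, doubleTrace_smul, l2Inner_add_left (affineIndependent_of_subset hF hσ)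
      hFne (doubleTrace_mem_whitney hF hω) (Submodule.smul_mem _ _ hη') b.2.1, l2Inner_smul_left,
      h F hF hFne b]
    ring
  funext x
  ext v u
  have hx := congrArg (fun α : Alt k ℓ (tangent σ) => α v u) (congrFun h0 x)
  simp only [Pi.add_apply, Pi.smul_apply, AlternatingMap.add_apply, AlternatingMap.smul_apply,
    Pi.zero_apply, AlternatingMap.zero_apply, smul_eq_mul] at hx
  linarith

/-- Degrees of freedom can be prescribed on any set of subsimplices. -/
theorem exists_whitney_dof_eq {K : Finset (E d)} (hK : AffineIndependent ℝ ((↑) : K → E d))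
    (g : (σ : Finset (E d)) → Module.Dual ℝ (bubble k ℓ σ)) (S : Finset (Finset (E d))) :
    ∃ ω ∈ whitney k ℓ K, ∀ σ ∈ S, ∀ h : σ ⊆ K, σ.Nonempty → ∀ b : bubble k ℓ σ,
      dof h b ω = g σ b := by
  classical
  -- Subsimplices are inserted in order of nondecreasing dimension.
  refine Finset.induction_on_max_value (f := Finset.card) S ⟨0, Submodule.zero_mem _, by simp⟩ ?_
  rintro τ S hτS hmax ⟨ω, hω, hωg⟩
  by_cases hτ : τ ⊆ K ∧ τ.Nonempty
  swap
  · refine ⟨ω, hω, fun σ hσ h hne b => ?_⟩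
    rcases Finset.mem_insert.1 hσ with rfl | hσ
    · exact absurd ⟨h, hne⟩ hτ
    · exact hωg σ hσ h hne b
  obtain ⟨hτK, hτne⟩ := hτ
  have hτi := affineIndependent_of_subset hτK hK
  -- `b` represents the defect of `ω` on `τ`.
  obtain ⟨b, hb⟩ := exists_bubble_l2Inner_eq hτi hτne
    (g τ - l2Functional hτi hτne (doubleTrace_mem_whitney hτK hω))
  obtain ⟨η, hη, hητ, hη0⟩ := exists_bubble_extension hK hτK b
  refine ⟨ω + η, Submodule.add_mem _ hω hη, fun σ hσ h hne b' => ?_⟩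
  rw [dof, doubleTrace_add, l2Inner_add_left (affineIndependent_of_subset h hK) hne
    (doubleTrace_mem_whitney h hω) (doubleTrace_mem_whitney h hη) b'.2.1]
  by_cases hστ : σ = τ
  · subst hστ
    rw [hητ, hb b']
    exact add_sub_cancel _ _
  · have hσS := Finset.mem_of_mem_insert_of_ne hσ hστ
    -- An earlier `σ` has at most as many vertices as `τ`, so it cannot contain `τ` without being
    -- equal to it; the correction has zero trace there.
    rw [hη0 σ h fun hsub => hστ (Finset.eq_of_subset_of_card_le hsub (hmax σ hσS)).symm]
    have h0 := l2Inner_smul_left σ 0 (0 : FormField k ℓ σ) b'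
    rw [smul_zero, zero_mul] at h0
    rw [h0, add_zero]
    exact hωg σ hσS h hne b'

theorem unisolvent {K : Finset (E d)} (hK : AffineIndependent ℝ ((↑) : K → E d))
    (hne : K.Nonempty) : Unisolvent k ℓ K := by
  intro g
  obtain ⟨ω, hω, hωg⟩ := exists_whitney_dof_eq hK g K.powerset
  have hωg' : ∀ (σ : Finset (E d)) (h : σ ⊆ K), σ.Nonempty → ∀ b : bubble k ℓ σ,
      dof h b ω = g σ b := fun σ h => hωg σ (Finset.mem_powerset.2 h) h
  refine ⟨ω, ⟨hω, hωg'⟩, fun η ⟨hη, hηg⟩ => eq_of_l2Inner_eq hK hne hη hω ?_⟩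
  exact fun F hF hFne b => (hηg F hF hFne b).trans (hωg' F hF hFne b).symm

theorem isConforming_of_mem_feSpace {n : ℕ} {T : Geometry.SimplicialComplex ℝ (E d)}
    {ω : (K : Cells T n) → FormField k ℓ K.1} (hω : ω ∈ feSpace n k ℓ T) : IsConforming ω := by
  intro σ hσ K K' h h'
  refine eq_of_l2Inner_eq (T.indep hσ) (T.nonempty_of_mem_faces hσ)
    (doubleTrace_mem_whitney h (hω.1 K)) (doubleTrace_mem_whitney h' (hω.1 K')) ?_
  exact fun F hF hFne b =>
    hω.2 F (T.down_closed hσ hF hFne) K K' (hF.trans h) (hF.trans h') b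

end FormValued

end

theorem mainTheorem1 (d n k ℓ : ℕ) :
    (∀ K : Finset (FormValued.E d), AffineIndependent ℝ ((↑) : K → FormValued.E d) →
      K.card = n + 1 → FormValued.Unisolvent k ℓ K) ∧
    (∀ T : Geometry.SimplicialComplex ℝ (FormValued.E d),
      ∀ ω ∈ FormValued.feSpace n k ℓ T, FormValued.IsConforming ω) :=
  ⟨fun _ hK hcard => FormValued.unisolvent hK (Finset.card_pos.1 (hcard ▸ n.succ_pos)),
    fun _ _ hω => FormValued.isConforming_of_mem_feSpace hω⟩
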